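/- Let $F$ be a field and let $D$ be a subring of $F$ (not necessarily with quotient field $F$). Let $\mathfrak{X}$ be the Zariski–Riemann space of $F/D$: the set of all subrings $V$ of $F$ with $D \subseteq V$ such that for each nonzero $x \in F$ we have $x \in V$ or $x^{-1} \in V$ (so $F \in \mathfrak{X}$), with the topology whose basic open sets are the sets $\{V \in \mathfrak{X} : t_1,\ldots,t_n \in V\}$ with $t_1,\ldots,t_n \in F$. Let $Z$ be a subspace of $\mathfrak{X}$ with $F \in Z$, and let $A = \bigcap_{V \in Z} V$. View $Z$ as a locally ringed space whose structure sheaf is given by $\mathcal{O}_Z(U) = \bigcap_{V \in U} V$ for each nonempty open subset $U$ of $Z$ and $\mathcal{O}_Z(\emptyset) = 0$, the restriction maps between nonempty open sets being inclusions. Let $Z \to \operatorname{Spec}(D)$ be the morphism of locally ringed spaces that sends $V \in Z$ to its center in $D$ (the set of elements of $D$ that are not units of $V$) and that is given by inclusions on sections over nonempty open sets. Let $\mathbb{P}^1_D = \operatorname{Proj}(D[T_0,T_1])$ with its usual morphism to $\operatorname{Spec}(D)$. A $D$-morphism $Z \to \mathbb{P}^1_D$ is a morphism of locally ringed spaces whose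 composition with $\mathbb{P}^1_D \to \operatorname{Spec}(D)$ is the morphism $Z \to \operatorname{Spec}(D)$ above. Then $A$ is a Prüfer domain (that is, an integral domain for which $A_P$ is a valuation ring for each prime ideal $P$ of $A$) with quotient field $F$ if and only if every $D$-morphism $\phi : Z \to \mathbb{P}^1_D$ factors through an affine scheme, i.e. there are an affine scheme $S$, a morphism of locally ringed spaces $\delta : Z \to S$ and a morphism of schemes $\gamma : S \to \mathbb{P}^1_D$ such that $\phi = \gamma \circ \delta$. -/

import Mathlib

open CategoryTheory AlgebraicGeometry TopologicalSpace Opposite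

universe u

/-- A Prüfer domain: an integral domain whose localization at every prime ideal is a valuation
ring (of its quotient field). -/
class IsPruferDomain (R : Type u) [CommRing R] [IsDomain R] : Prop where
  valuationRing_localization : ∀ (P : Ideal R) [P.IsPrime], ValuationRing (Localization.AtPrime P)

/-- The Zariski–Riemann space of `F / D`: all valuation rings of `F` (including `F` itself) that
contain the subring `D`. -/
def ZariskiRiemannSpace {F : Type u} [Field F] (D : Subring F) : Type u :=
  {V : ValuationSubring F // D ≤ V.toSubring}

namespace ZariskiRiemannSpace

variable {F : Type u} [Field F] {D : Subring F}

/-- The valuation ring underlying a point. -/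
def ring (V : ZariskiRiemannSpace D) : ValuationSubring F := V.1

lemma le_ring (V : ZariskiRiemannSpace D) : D ≤ V.ring.toSubring := V.2

/-- The trivial valuation ring `F`, viewed as a point of the Zariski–Riemann space. -/
def trivialRing (D : Subring F) : ZariskiRiemannSpace D := ⟨⊤, fun _ _ => trivial⟩

lemma mem_trivialRing (x : F) : x ∈ (trivialRing D).ring := trivial

/-- The Zariski topology: the sets `{V | t₁, …, tₙ ∈ V}`, for `t₁, …, tₙ ∈ F`, form a basis. -/
instance : TopologicalSpace (ZariskiRiemannSpace D) :=
  generateFrom {U | ∃ s : Finset F, U = {V | ∀ t ∈ s, t ∈ V.ring}}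

lemma isOpen_setOf_mem (t : F) : IsOpen {V : ZariskiRiemannSpace D | t ∈ V.ring} :=
  isOpen_generateFrom_of_mem ⟨{t}, by simp⟩

/-- `F` is a generic point of the Zariski–Riemann space. -/
lemma trivialRing_mem_of_isOpen {U : Set (ZariskiRiemannSpace D)} (hU : IsOpen U)
    (hne : U.Nonempty) : trivialRing D ∈ U := by
  induction hU with
  | basic U hU =>
    obtain ⟨s, rfl⟩ := hU
    exact fun t _ => mem_trivialRing t
  | univ => trivial
  | inter U₁ U₂ _ _ h₁ h₂ => exact ⟨h₁ hne.left, h₂ hne.right⟩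
  | sUnion S _ h =>
    obtain ⟨x, U, hUS, hxU⟩ := hne
    exact ⟨U, hUS, h U hUS ⟨x, hxU⟩⟩

section Subspace

variable (Z : Set (ZariskiRiemannSpace D))

/-- The holomorphy ring `A = ⋂_{V ∈ Z} V` of a subspace `Z`. -/
def holomorphyRing : Subring F := ⨅ V ∈ Z, V.ring.toSubring

/-- The subspace `Z` as a topological space, with the subspace topology. -/
abbrev topSpace : TopCat.{u} := TopCat.of Z

variable {Z}

/-- The sections of the holomorphy sheaf over an open set `U ⊆ Z`. An element `c` of
`⋂_{V ∈ U} V` is recorded as the constant function on `U` with value `c`. For nonempty `U` this is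
the ring `⋂_{V ∈ U} V` (see `sectionsEquiv`), and for `U = ∅` it is the zero ring. -/
def sections (U : Opens (topSpace Z)) : Subring (U → F) where
  carrier := {s | ∃ c : F, ∀ V : U, s V = c ∧ c ∈ V.1.1.ring}
  zero_mem' := ⟨0, fun V => ⟨rfl, V.1.1.ring.zero_mem⟩⟩
  one_mem' := ⟨1, fun V => ⟨rfl, V.1.1.ring.one_mem⟩⟩
  add_mem' := by
    rintro s t ⟨c, hc⟩ ⟨d, hd⟩
    exact ⟨c + d, fun V => ⟨congrArg₂ _ (hc V).1 (hd V).1,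
      V.1.1.ring.add_mem _ _ (hc V).2 (hd V).2⟩⟩
  mul_mem' := by
    rintro s t ⟨c, hc⟩ ⟨d, hd⟩
    exact ⟨c * d, fun V => ⟨congrArg₂ _ (hc V).1 (hd V).1,
      V.1.1.ring.mul_mem _ _ (hc V).2 (hd V).2⟩⟩
  neg_mem' := by
    rintro s ⟨c, hc⟩
    exact ⟨-c, fun V => ⟨congrArg _ (hc V).1, V.1.1.ring.neg_mem _ (hc V).2⟩⟩

/-- The constant section with value `c`. -/
def constSection (U : Opens (topSpace Z)) (c : F) (hc : ∀ V : U, c ∈ V.1.1.ring) : sections U :=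
  ⟨fun _ => c, c, fun V => ⟨rfl, hc V⟩⟩

/-- For a nonempty open set `U`, the ring of sections over `U` is `⋂_{V ∈ U} V`. -/
noncomputable def sectionsEquiv (U : Opens (topSpace Z)) (V₀ : U) :
    sections U ≃+* (⨅ V : U, V.1.1.ring.toSubring : Subring F) where
  toFun s := ⟨s.1 V₀, by
    obtain ⟨c, hc⟩ := s.2
    refine Subring.mem_iInf.2 fun V => ?_
    rw [(hc V₀).1]
    exact (hc V).2⟩
  invFun c := constSection U c.1 fun V => Subring.mem_iInf.1 c.2 V
  left_inv s := by
    obtain ⟨c, hc⟩ := s.2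
    refine Subtype.ext (funext fun V => ?_)
    exact (hc V₀).1.trans (hc V).1.symm
  right_inv _ := rfl
  map_mul' _ _ := rfl
  map_add' _ _ := rfl

/-- The holomorphy presheaf. Its restriction maps are restrictions of (constant) functions, i.e.
inclusions of subrings of `F` as long as the smaller open set is nonempty. -/
def holomorphyPresheaf (Z : Set (ZariskiRiemannSpace D)) :
    TopCat.Presheaf CommRingCat.{u} (topSpace Z) where
  obj U := CommRingCat.of (sections U.unop)
  map i := CommRingCat.ofHom
    { toFun := fun s => ⟨fun V => s.1 ⟨V.1, i.unop.le V.2⟩,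
        s.2.imp fun _ hc V => hc ⟨V.1, i.unop.le V.2⟩⟩
      map_zero' := rfl
      map_one' := rfl
      map_add' := fun _ _ => rfl
      map_mul' := fun _ _ => rfl }
  map_id _ := rfl
  map_comp _ _ := rfl

/-- Being a section of the holomorphy presheaf is a local condition, because `F ∈ Z` lies in every
nonempty open subset of `Z`. -/
def holomorphyPredicate (hZ : trivialRing D ∈ Z) :
    TopCat.LocalPredicate fun _ : topSpace Z => F where
  pred {U} s := s ∈ sections U
  res i s hs := hs.imp fun _ hc V => hc ⟨V.1, i.le V.2⟩
  locality {U} s h := by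
    have key : ∀ W : Opens (topSpace Z), (∃ V, V ∈ W) → (⟨trivialRing D, hZ⟩ : Z) ∈ W := by
      rintro W ⟨V, hV⟩
      obtain ⟨O, hO, hOW⟩ := isOpen_induced_iff.1 W.2
      have hVO : V ∈ Subtype.val ⁻¹' O := hOW ▸ hV
      have : (⟨trivialRing D, hZ⟩ : Z) ∈ Subtype.val ⁻¹' O :=
        trivialRing_mem_of_isOpen hO ⟨V.1, hVO⟩
      exact hOW.subset this
    by_cases hU : ∃ V, V ∈ U
    · refine ⟨s ⟨_, key U hU⟩, fun V => ?_⟩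
      obtain ⟨W, hVW, i, c, hc⟩ := h V
      have h₁ := hc ⟨_, key W ⟨_, hVW⟩⟩
      have h₂ := hc ⟨V.1, hVW⟩
      refine ⟨h₂.1.trans h₁.1.symm, ?_⟩
      have h₃ : s ⟨_, key U hU⟩ = c := h₁.1
      rw [h₃]
      exact h₂.2
    · exact ⟨0, fun V => (hU ⟨V.1, V.2⟩).elim⟩

lemma holomorphyPresheaf_isSheaf (hZ : trivialRing D ∈ Z) : (holomorphyPresheaf Z).IsSheaf := by
  rw [TopCat.Presheaf.isSheaf_iff_isSheaf_comp (forget CommRingCat.{u})]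
  refine TopCat.Presheaf.isSheaf_of_iso ?_ (TopCat.subsheafToTypes (holomorphyPredicate hZ)).2
  exact NatIso.ofComponents (fun _ => Iso.refl _) (fun _ => rfl)

/-- The value at `V` of a section defined near `V`, as an element of the valuation ring `V`. -/
def evalSection (U : Opens (topSpace Z)) (V : topSpace Z) (hV : V ∈ U) :
    sections U →+* V.1.ring where
  toFun s := ⟨s.1 ⟨V, hV⟩, by obtain ⟨c, hc⟩ := s.2; rw [(hc ⟨V, hV⟩).1]; exact (hc ⟨V, hV⟩).2⟩
  map_zero' := rfl
  map_one' := rfl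
  map_add' _ _ := rfl
  map_mul' _ _ := rfl

/-- The map from the stalk at `V` to the valuation ring `V`. -/
noncomputable def stalkToRing (V : topSpace Z) :
    (holomorphyPresheaf Z).stalk V ⟶ CommRingCat.of V.1.ring :=
  Limits.colimit.desc ((OpenNhds.inclusion V).op ⋙ holomorphyPresheaf Z)
    { pt := _
      ι := { app := fun U => CommRingCat.ofHom
              (evalSection ((OpenNhds.inclusion V).obj U.unop) V U.unop.2) } }

lemma stalkToRing_germ (U : Opens (topSpace Z)) (V : topSpace Z) (hV : V ∈ U) :
    (holomorphyPresheaf Z).germ U V hV ≫ stalkToRing V = CommRingCat.ofHom (evalSection U V hV) :=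
  Limits.colimit.ι_desc _ _

lemma stalkToRing_germ_apply (U : Opens (topSpace Z)) (V : topSpace Z) (hV : V ∈ U)
    (s : sections U) :
    (stalkToRing V).hom (((holomorphyPresheaf Z).germ U V hV).hom s) = evalSection U V hV s :=
  RingHom.congr_fun (congrArg CommRingCat.Hom.hom (stalkToRing_germ U V hV)) s

/-- The stalk of the holomorphy sheaf at `V` is the valuation ring `V`. -/
lemma stalkToRing_bijective (V : topSpace Z) : Function.Bijective (stalkToRing V).hom := by
  constructor
  · rw [injective_iff_map_eq_zero]
    intro x hx
    obtain ⟨U, hV, s, rfl⟩ := (holomorphyPresheaf Z).exists_germ_eq x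
    have h0 : s = (0 : sections U) := by
      have h := (stalkToRing_germ_apply U V hV s).symm.trans hx
      have h' : (s : sections U).1 ⟨V, hV⟩ = 0 := congrArg Subtype.val h
      obtain ⟨c, hc⟩ := (s : sections U).2
      refine Subtype.ext (funext fun W => ?_)
      exact (hc W).1.trans ((hc ⟨V, hV⟩).1.symm.trans h')
    subst h0
    exact map_zero _
  · intro c
    let U : Opens (topSpace Z) :=
      ⟨{W | c.1 ∈ W.1.ring}, (isOpen_setOf_mem c.1).preimage continuous_subtype_val⟩
    have hV : V ∈ U := c.2
    exact ⟨_, stalkToRing_germ_apply U V hV (constSection U c.1 fun W => W.2)⟩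

/-- A subspace `Z` of the Zariski–Riemann space with `F ∈ Z`, as a locally ringed space with the
holomorphy sheaf as structure sheaf. -/
noncomputable def locallyRingedSpace (Z : Set (ZariskiRiemannSpace D)) (hZ : trivialRing D ∈ Z) :
    LocallyRingedSpace.{u} where
  carrier := topSpace Z
  presheaf := holomorphyPresheaf Z
  IsSheaf := holomorphyPresheaf_isSheaf hZ
  isLocalRing V := (RingEquiv.ofBijective _ (stalkToRing_bijective V)).symm.isLocalRing

/-- The inclusion of `D` into the ring of global sections of `Z`. -/
def toGlobalSections (Z : Set (ZariskiRiemannSpace D)) :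
    D →+* sections (⊤ : Opens (topSpace Z)) where
  toFun d := constSection ⊤ d.1 fun V => V.1.1.le_ring d.2
  map_zero' := rfl
  map_one' := rfl
  map_add' _ _ := rfl
  map_mul' _ _ := rfl

/-- The structure morphism `Z ⟶ Spec D`: the morphism of locally ringed spaces that corresponds to
the inclusion of `D` into the ring of global sections of `Z`. It sends `V` to its center in `D`
(see `structureMorphism_base_apply`). -/
noncomputable def structureMorphism (Z : Set (ZariskiRiemannSpace D)) (hZ : trivialRing D ∈ Z) :
    locallyRingedSpace Z hZ ⟶ (Spec (CommRingCat.of D)).toLocallyRingedSpace :=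
  (locallyRingedSpace Z hZ).toΓSpec ≫
    Spec.locallyRingedSpaceMap (CommRingCat.ofHom (toGlobalSections Z))

/-- The structure morphism maps `V` to the center of `V` in `D`: the set of those elements of `D`
that are not units of `V`. -/
lemma structureMorphism_base_apply (hZ : trivialRing D ∈ Z) (V : topSpace Z) (d : D) :
    d ∈ PrimeSpectrum.asIdeal ((structureMorphism Z hZ).base V) ↔
      (⟨d.1, V.1.le_ring d.2⟩ : V.1.ring) ∈ IsLocalRing.maximalIdeal V.1.ring := by
  have h : d ∉ PrimeSpectrum.asIdeal ((structureMorphism Z hZ).base V) ↔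
      IsUnit (((holomorphyPresheaf Z).germ ⊤ V trivial).hom (toGlobalSections Z d)) :=
    (locallyRingedSpace Z hZ).notMem_prime_iff_unit_in_stalk (toGlobalSections Z d) V
  have h' := MulEquiv.isUnit_map (RingEquiv.ofBijective _ (stalkToRing_bijective V))
    (x := ((holomorphyPresheaf Z).germ ⊤ V trivial).hom (toGlobalSections Z d))
  have h'' : (RingEquiv.ofBijective _ (stalkToRing_bijective V))
      (((holomorphyPresheaf Z).germ ⊤ V trivial).hom (toGlobalSections Z d)) =
        (⟨d.1, V.1.le_ring d.2⟩ : V.1.ring) :=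
    stalkToRing_germ_apply ⊤ V trivial (toGlobalSections Z d)
  rw [h''] at h'
  rw [IsLocalRing.mem_maximalIdeal, mem_nonunits_iff, ← not_iff_not, not_not, h, ← h']

end Subspace

end ZariskiRiemannSpace

section ProjectiveLine

attribute [local instance] MvPolynomial.gradedAlgebra

/-- The projective line `Proj R[T₀, T₁]` over `R`. -/
noncomputable def projectiveLine (R : Type u) [CommRing R] : Scheme.{u} :=
  Proj (MvPolynomial.homogeneousSubmodule (Fin 2) R)

/-- The structure morphism of the projective line over `R`. -/
noncomputable def projectiveLineToSpec (R : Type u) [CommRing R] :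
    projectiveLine R ⟶ Spec (CommRingCat.of R) :=
  Proj.toSpecZero (MvPolynomial.homogeneousSubmodule (Fin 2) R) ≫
    Spec.map (CommRingCat.ofHom (algebraMap R (MvPolynomial.homogeneousSubmodule (Fin 2) R 0)))

end ProjectiveLine

/-- A morphism from a locally ringed space to a scheme factors through an affine scheme. -/
def FactorsThroughAffine {X : LocallyRingedSpace.{u}} {Y : Scheme.{u}}
    (φ : X ⟶ Y.toLocallyRingedSpace) : Prop :=
  ∃ (S : Scheme.{u}) (_ : IsAffine S) (δ : X ⟶ S.toLocallyRingedSpace) (γ : S ⟶ Y),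
    δ ≫ γ.toLRSHom = φ

/-! A morphism from `Z` to a scheme `Y` amounts to a family of morphisms `Spec V ⟶ Y`, one for each
`V` in `Z`, that restrict to one and the same `F`-valued point and whose closed points vary
continuously with `V` (`inclusion_localMap`, `hom_ext_of_localMap`, `exists_hom_localMap_eq`). If
`Y` is proper over `D`, the valuative criterion shows that the `F`-valued point determines the whole
family and that every `F`-valued point over `D` extends to each `Spec V`; continuity comes from
finite type. Thus `D`-morphisms `Z ⟶ Y` are the same as `F`-valued points of `Y` over `D`
(`hom_ext_of_genericMap`, `exists_hom_genericMap_eq`).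

If `A` is Prüfer with quotient field `F`, the stalks of `Spec A` are valuation rings, so the
`F`-valued point of `φ` extends over each stalk, spreads out to neighbourhoods, and gives `γ : Spec
A ⟶ ℙ¹` (`IsPruferDomain.exists_extension`). The composite `Z ⟶ Spec A ⟶ ℙ¹` equals `φ` because it
has the same `F`-valued point.

Conversely, let `t ≠ 0` and let `φ` be the morphism with `F`-valued point `[1 : t]`. A morphism from
`Z` to an affine scheme is given by global sections, which lie in `A`; so a factorization of `φ`
extends `[1 : t]` to `Spec A`, hence to `Spec A_P` for each prime `P`. As `A_P` is local, its
spectrum lands in a single standard chart, which forces `t ∈ A_P` or `t⁻¹ ∈ A_P`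
(`mem_range_or_inv_mem_range`). -/

namespace AlgebraicGeometry.Scheme

/-! ### Evaluation of sections along morphisms from spectra -/

/-- The value of a section over `U` along a morphism `Spec R ⟶ Y` with image in `U`. -/
noncomputable def evalAlong {Y : Scheme.{u}} {R : CommRingCat.{u}} (f : Spec R ⟶ Y) (U : Y.Opens)
    (h : ⊤ ≤ f ⁻¹ᵁ U) : Γ(Y, U) ⟶ R :=
  f.appLE U ⊤ h ≫ (ΓSpecIso R).hom

lemma evalAlong_congr {Y : Scheme.{u}} {R : CommRingCat.{u}} {f g : Spec R ⟶ Y} (e : f = g)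
    (U : Y.Opens) (h : ⊤ ≤ f ⁻¹ᵁ U) :
    evalAlong f U h = evalAlong g U (e ▸ h) := by
  subst e; rfl

lemma evalAlong_specMap_comp {Y : Scheme.{u}} {R S : CommRingCat.{u}} (f : Spec R ⟶ Y) (ρ : R ⟶ S)
    (U : Y.Opens) (h : ⊤ ≤ f ⁻¹ᵁ U) (h' : ⊤ ≤ (Spec.map ρ ≫ f) ⁻¹ᵁ U) :
    evalAlong (Spec.map ρ ≫ f) U h' = evalAlong f U h ≫ ρ := by
  have : (Spec.map ρ ≫ f).appLE U ⊤ h' = f.appLE U ⊤ h ≫ (Spec.map ρ).appTop := by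
    rw [← Scheme.Hom.appLE_comp_appLE (Spec.map ρ) f U ⊤ ⊤ h le_top]
    exact congr(_ ≫ $((Scheme.Hom.app_eq_appLE (Spec.map ρ) (U := ⊤)).symm))
  rw [evalAlong, evalAlong, this, Category.assoc, Category.assoc, ΓSpecIso_naturality]

lemma evalAlong_map {Y : Scheme.{u}} {R : CommRingCat.{u}} (f : Spec R ⟶ Y) {U U' : Y.Opens}
    (i : U' ≤ U) (h : ⊤ ≤ f ⁻¹ᵁ U') (h' : ⊤ ≤ f ⁻¹ᵁ U) :
    Y.presheaf.map (homOfLE i).op ≫ evalAlong f U' h = evalAlong f U h' := by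
  simp [evalAlong]

lemma evalAlong_top_toSpecΓ {Y : Scheme.{u}} {R : CommRingCat.{u}} (f : Spec R ⟶ Y) :
    Spec.map (evalAlong f ⊤ le_rfl) = f ≫ Y.toSpecΓ := by
  have h : evalAlong f ⊤ le_rfl = f.appTop ≫ (ΓSpecIso R).hom :=
    congr($((Scheme.Hom.app_eq_appLE f (U := ⊤)).symm) ≫ (ΓSpecIso R).hom)
  rw [h, toSpecΓ_naturality, ← SpecMap_ΓSpecIso_hom, ← Spec.map_comp]

section Local

variable {Y : Scheme.{u}} {R : CommRingCat.{u}} [IsLocalRing R]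

lemma top_le_preimage {f : Spec R ⟶ Y} {U : Y.Opens} (h : f (IsLocalRing.closedPoint R) ∈ U) :
    ⊤ ≤ f ⁻¹ᵁ U :=
  (preimage_eq_top_of_closedPoint_mem f h).ge

lemma germ_stalkClosedPointTo_eq_evalAlong (f : Spec R ⟶ Y) (U : Y.Opens)
    (h : f (IsLocalRing.closedPoint R) ∈ U) :
    Y.presheaf.germ U _ h ≫ stalkClosedPointTo f = evalAlong f U (top_le_preimage h) := by
  rw [germ_stalkClosedPointTo, evalAlong, Hom.appLE, Category.assoc]
  rfl

/-- Since `ρ` is local, the closed point of `Spec R` goes to `y`, and `ρ` is recovered as the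
induced map on the stalk there. -/
lemma evalAlong_specMap_fromSpecStalk {y : Y} (ρ : Y.presheaf.stalk y ⟶ R) [IsLocalHom ρ.hom]
    (U : Y.Opens) (h : y ∈ U) (h') :
    evalAlong (Spec.map ρ ≫ Y.fromSpecStalk y) U h' = Y.presheaf.germ U y h ≫ ρ := by
  have hU : (Spec.map ρ ≫ Y.fromSpecStalk y) (IsLocalRing.closedPoint R) ∈ U :=
    h' (show IsLocalRing.closedPoint R ∈ (⊤ : (Spec R).Opens) from trivial)
  rw [← germ_stalkClosedPointTo_eq_evalAlong _ _ hU, germ_stalkClosedPointTo_Spec_fromSpecStalk]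

end Local

end AlgebraicGeometry.Scheme

/-! ### Morphisms from `Z` as compatible families of morphisms `Spec V ⟶ Y` -/

namespace ZariskiRiemannSpace

open AlgebraicGeometry.Scheme

variable {F : Type u} [Field F] {D : Subring F} {Z : Set (ZariskiRiemannSpace D)}
  {hZ : trivialRing D ∈ Z} {Y : Scheme.{u}}

/-- The valuation ring at a point of the locally ringed space `Z`. -/
def ringAt (V : locallyRingedSpace Z hZ) : CommRingCat.{u} :=
  CommRingCat.of (V : topSpace Z).1.ring

instance (V : locallyRingedSpace Z hZ) : IsLocalRing (ringAt V) :=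
  inferInstanceAs (IsLocalRing (V : topSpace Z).1.ring)

/-- The inclusion of a valuation ring of `F` in `F`. -/
def inclusion (V : locallyRingedSpace Z hZ) : ringAt V ⟶ CommRingCat.of F :=
  CommRingCat.ofHom (V : topSpace Z).1.ring.subtype

lemma inclusion_injective (V : locallyRingedSpace Z hZ) : Function.Injective (inclusion V).hom :=
  Subtype.val_injective

/-- The value of a section at a point. -/
def evalAt (U : Opens (locallyRingedSpace Z hZ)) (V : locallyRingedSpace Z hZ) (hV : V ∈ U) :
    (locallyRingedSpace Z hZ).presheaf.obj (op U) ⟶ ringAt V :=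
  CommRingCat.ofHom (evalSection U V hV)

lemma section_ext {U : Opens (locallyRingedSpace Z hZ)}
    {s t : (locallyRingedSpace Z hZ).presheaf.obj (op U)}
    (h : ∀ V hV, (evalAt U V hV).hom s = (evalAt U V hV).hom t) : s = t :=
  Subtype.ext (funext fun V => congr(Subtype.val $(h V.1 V.2)))

lemma evalAt_comp_inclusion (U : Opens (locallyRingedSpace Z hZ)) (V W : locallyRingedSpace Z hZ)
    (hV : V ∈ U) (hW : W ∈ U) :
    evalAt U V hV ≫ inclusion V = evalAt U W hW ≫ inclusion W := by
  ext s
  obtain ⟨c, hc⟩ := (show sections U from s).2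
  exact (hc ⟨V, hV⟩).1.trans (hc ⟨W, hW⟩).1.symm

/-- The generic point `F` of `Z`. -/
def generic (hZ : trivialRing D ∈ Z) : locallyRingedSpace Z hZ :=
  (⟨trivialRing D, hZ⟩ : topSpace Z)

lemma generic_mem {U : Opens (locallyRingedSpace Z hZ)} {V : locallyRingedSpace Z hZ}
    (hV : V ∈ U) : generic hZ ∈ U := by
  obtain ⟨O, hO, hOU⟩ := isOpen_induced_iff.1 U.2
  have hVO : V ∈ Subtype.val ⁻¹' O := hOU ▸ hV
  have : generic hZ ∈ Subtype.val ⁻¹' O := trivialRing_mem_of_isOpen hO ⟨_, hVO⟩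
  exact hOU.subset this

/-- The isomorphism of the stalk at `V` with `V`. -/
noncomputable def stalkTo (V : locallyRingedSpace Z hZ) :
    (locallyRingedSpace Z hZ).presheaf.stalk V ⟶ ringAt V :=
  stalkToRing V

instance (V : locallyRingedSpace Z hZ) : IsIso (stalkTo V) :=
  (ConcreteCategory.isIso_iff_bijective _).2 (stalkToRing_bijective V)

lemma germ_stalkTo (U : Opens (locallyRingedSpace Z hZ)) (V : locallyRingedSpace Z hZ)
    (hV : V ∈ U) :
    (locallyRingedSpace Z hZ).presheaf.germ U V hV ≫ stalkTo V = evalAt U V hV :=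
  stalkToRing_germ U V hV

/-- The local homomorphism `𝒪_{Y, φ(V)} ⟶ V` induced by a morphism `φ : Z ⟶ Y`. -/
noncomputable def stalkHom (φ : locallyRingedSpace Z hZ ⟶ Y.toLocallyRingedSpace)
    (V : locallyRingedSpace Z hZ) : Y.presheaf.stalk (φ.base V) ⟶ ringAt V :=
  LocallyRingedSpace.Hom.stalkMap φ V ≫ stalkTo V

instance (φ : locallyRingedSpace Z hZ ⟶ Y.toLocallyRingedSpace) (V : locallyRingedSpace Z hZ) :
    IsLocalHom (stalkHom φ V).hom := by
  have h₁ : IsLocalHom (LocallyRingedSpace.Hom.stalkMap φ V).hom :=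
    LocallyRingedSpace.isLocalHomStalkMap φ V
  have h₂ : IsLocalHom (stalkTo V).hom := inferInstance
  exact RingHom.isLocalHom_comp (stalkTo V).hom (LocallyRingedSpace.Hom.stalkMap φ V).hom

lemma germ_stalkHom (φ : locallyRingedSpace Z hZ ⟶ Y.toLocallyRingedSpace)
    (V : locallyRingedSpace Z hZ) (U : Y.Opens) (h : φ.base V ∈ U) :
    Y.presheaf.germ U (φ.base V) h ≫ stalkHom φ V =
      φ.c.app (op U) ≫ evalAt ((Opens.map φ.base).obj U) V h := by
  have := LocallyRingedSpace.stalkMap_germ φ U V h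
  exact congr($this ≫ stalkTo V).trans
    congr(φ.c.app (op U) ≫ $(germ_stalkTo ((Opens.map φ.base).obj U) V h))

/-- The morphism `Spec V ⟶ Y` induced by a morphism `φ : Z ⟶ Y`. -/
noncomputable def localMap (φ : locallyRingedSpace Z hZ ⟶ Y.toLocallyRingedSpace)
    (V : locallyRingedSpace Z hZ) : Spec (ringAt V) ⟶ Y :=
  Spec.map (stalkHom φ V) ≫ Y.fromSpecStalk (φ.base V)

lemma localMap_closedPoint (φ : locallyRingedSpace Z hZ ⟶ Y.toLocallyRingedSpace)
    (V : locallyRingedSpace Z hZ) :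
    localMap φ V (IsLocalRing.closedPoint (ringAt V)) = φ.base V := by
  have h₁ : Spec.map (stalkHom φ V) (IsLocalRing.closedPoint (ringAt V)) =
    IsLocalRing.closedPoint (Y.presheaf.stalk (φ.base V)) := Spec_closedPoint
  have h₂ := Scheme.fromSpecStalk_closedPoint (X := Y) (x := φ.base V)
  refine (Hom.comp_apply _ _ _).trans ?_
  exact congr(Y.fromSpecStalk (φ.base V) $h₁).trans h₂

lemma top_le_preimage_localMap {φ : locallyRingedSpace Z hZ ⟶ Y.toLocallyRingedSpace}
    {V : locallyRingedSpace Z hZ} {U : Y.Opens} (h : φ.base V ∈ U) : ⊤ ≤ localMap φ V ⁻¹ᵁ U :=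
  top_le_preimage ((localMap_closedPoint φ V).symm ▸ h)

lemma evalAlong_localMap (φ : locallyRingedSpace Z hZ ⟶ Y.toLocallyRingedSpace)
    (V : locallyRingedSpace Z hZ) (U : Y.Opens) (h : φ.base V ∈ U) (h') :
    evalAlong (localMap φ V) U h' =
      φ.c.app (op U) ≫ evalAt ((Opens.map φ.base).obj U) V h := by
  rw [← germ_stalkHom]
  exact evalAlong_specMap_fromSpecStalk _ _ h _

/-- The closed point of `Spec V` recovers the underlying map at `V`, and evaluation along `localMap
φ V` recovers the value at `V` of each pulled-back section; sections of `Z` are determined by these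
values. -/
lemma hom_ext_of_localMap {φ ψ : locallyRingedSpace Z hZ ⟶ Y.toLocallyRingedSpace}
    (h : ∀ V, localMap φ V = localMap ψ V) : φ = ψ := by
  have hb : φ.base = ψ.base := by
    ext V
    exact (localMap_closedPoint φ V).symm.trans
      (congr($(h V) (IsLocalRing.closedPoint (ringAt V))).trans (localMap_closedPoint ψ V))
  have hc : ∀ (V : locallyRingedSpace Z hZ) (U : Y.Opens) (hφ : φ.base V ∈ U)
      (hψ : ψ.base V ∈ U),
      φ.c.app (op U) ≫ evalAt ((Opens.map φ.base).obj U) V hφ =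
      ψ.c.app (op U) ≫ evalAt ((Opens.map ψ.base).obj U) V hψ := by
    intro V U hφ hψ
    rw [← evalAlong_localMap φ V U hφ (top_le_preimage_localMap hφ), evalAlong_congr (h V),
      evalAlong_localMap]
  obtain ⟨⟨b, c⟩, _⟩ := φ
  obtain ⟨⟨b', c'⟩, _⟩ := ψ
  obtain rfl : b = b' := hb
  have : c = c' := by
    ext U s
    exact section_ext fun V hV => congr(($(hc V U hV hV).hom s))
  subst this
  rfl

lemma generic_specializes (V : locallyRingedSpace Z hZ) : generic hZ ⤳ V :=
  specializes_iff_forall_open.2 fun U hU hV => generic_mem (U := ⟨U, hU⟩) hV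

lemma stalkTo_comp_inclusion (V : locallyRingedSpace Z hZ) :
    stalkTo V ≫ inclusion V = (locallyRingedSpace Z hZ).presheaf.stalkSpecializes
      (generic_specializes V) ≫ stalkTo (generic hZ) ≫ inclusion (generic hZ) := by
  refine TopCat.Presheaf.stalk_hom_ext _ fun U hU => ?_
  rw [TopCat.Presheaf.germ_stalkSpecializes_assoc, ← Category.assoc, ← Category.assoc,
    germ_stalkTo, germ_stalkTo, evalAt_comp_inclusion]

/-- The morphism `Spec F ⟶ Y` induced by a morphism `Z ⟶ Y`. -/
noncomputable def genericMap (φ : locallyRingedSpace Z hZ ⟶ Y.toLocallyRingedSpace) :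
    Spec (CommRingCat.of F) ⟶ Y :=
  Spec.map (inclusion (generic hZ)) ≫ localMap φ (generic hZ)

/-- The point `F` specializes to every `V`, and stalk maps commute with specialization maps. -/
lemma inclusion_localMap (φ : locallyRingedSpace Z hZ ⟶ Y.toLocallyRingedSpace)
    (V : locallyRingedSpace Z hZ) :
    Spec.map (inclusion V) ≫ localMap φ V = genericMap φ := by
  have h := LocallyRingedSpace.stalkSpecializes_stalkMap φ _ _ (generic_specializes V)
  have h' : stalkHom φ V ≫ inclusion V = Y.presheaf.stalkSpecializes
      (φ.base.hom.map_specializes (generic_specializes V)) ≫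
        stalkHom φ (generic hZ) ≫ inclusion (generic hZ) := by
    refine congr(LocallyRingedSpace.Hom.stalkMap φ V ≫ $(stalkTo_comp_inclusion V)).trans ?_
    exact congr($h.symm ≫ stalkTo (generic hZ) ≫ inclusion (generic hZ))
  refine (Spec.map_comp_assoc _ _ _).symm.trans ?_
  rw [h']
  refine (Spec.map_comp_assoc _ _ _).trans ?_
  refine Eq.trans ?_ (Spec.map_comp_assoc _ _ _)
  exact congr(Spec.map (stalkHom φ (generic hZ) ≫ inclusion (generic hZ)) ≫
    $(Scheme.SpecMap_stalkSpecializes_fromSpecStalk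
      (φ.base.hom.map_specializes (generic_specializes V))))

lemma localMap_comp {Y' : Scheme.{u}} (φ : locallyRingedSpace Z hZ ⟶ Y.toLocallyRingedSpace)
    (g : Y ⟶ Y') (V : locallyRingedSpace Z hZ) :
    localMap (φ ≫ g.toLRSHom) V = localMap φ V ≫ g := by
  have h : stalkHom (φ ≫ g.toLRSHom) V = g.stalkMap (φ.base V) ≫ stalkHom φ V :=
    congr($(LocallyRingedSpace.stalkMap_comp φ g.toLRSHom V) ≫ stalkTo V)
  rw [localMap, localMap, h]
  refine (Spec.map_comp_assoc _ _ _).trans ?_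
  rw [Category.assoc]
  exact congr(Spec.map (stalkHom φ V) ≫ $(Scheme.SpecMap_stalkMap_fromSpecStalk (f := g)))

lemma genericMap_comp {Y' : Scheme.{u}} (φ : locallyRingedSpace Z hZ ⟶ Y.toLocallyRingedSpace)
    (g : Y ⟶ Y') : genericMap (φ ≫ g.toLRSHom) = genericMap φ ≫ g := by
  rw [genericMap, localMap_comp, genericMap, Category.assoc]

/-- The morphism `Z ⟶ Spec R` that corresponds to a ring homomorphism `R ⟶ Γ(Z)`. -/
noncomputable def toSpec {R : CommRingCat.{u}}
    (ρ : R ⟶ (locallyRingedSpace Z hZ).presheaf.obj (op ⊤)) :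
    locallyRingedSpace Z hZ ⟶ (Spec R).toLocallyRingedSpace :=
  (locallyRingedSpace Z hZ).toΓSpec ≫ Spec.locallyRingedSpaceMap ρ

/-- This is a triangle identity of the adjunction between global sections and `Spec`. -/
lemma toSpec_c_app_top {R : CommRingCat.{u}}
    (ρ : R ⟶ (locallyRingedSpace Z hZ).presheaf.obj (op ⊤)) :
    (ΓSpecIso R).inv ≫ (toSpec ρ).c.app (op ⊤) = ρ := by
  have h₁ : ρ ≫ (ΓSpecIso _).inv = (ΓSpecIso R).inv ≫ (Spec.map ρ).appTop :=
    ΓSpecIso_inv_naturality ρ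
  have h₂ : (ΓSpecIso _).inv ≫ (locallyRingedSpace Z hZ).toΓSpec.c.app (op ⊤) = 𝟙 _ :=
    (locallyRingedSpace Z hZ).Γ_Spec_left_triangle
  refine Eq.trans ?_ (Category.comp_id ρ)
  refine Eq.trans ?_ congr(ρ ≫ $h₂)
  exact congr($h₁.symm ≫ (locallyRingedSpace Z hZ).toΓSpec.c.app (op ⊤))

lemma localMap_comp_toSpecΓ (φ : locallyRingedSpace Z hZ ⟶ Y.toLocallyRingedSpace)
    (V : locallyRingedSpace Z hZ) :
    localMap φ V ≫ Y.toSpecΓ = Spec.map (φ.c.app (op ⊤) ≫ evalAt ⊤ V trivial) := by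
  rw [← evalAlong_top_toSpecΓ]
  exact congr(Spec.map $(evalAlong_localMap φ V ⊤ trivial _))

lemma localMap_toSpec {R : CommRingCat.{u}}
    (ρ : R ⟶ (locallyRingedSpace Z hZ).presheaf.obj (op ⊤)) (V : locallyRingedSpace Z hZ) :
    localMap (toSpec ρ) V = Spec.map (ρ ≫ evalAt ⊤ V trivial) := by
  have h := localMap_comp_toSpecΓ (toSpec ρ) V
  rw [← SpecMap_ΓSpecIso_hom, ← IsIso.eq_comp_inv, ← Spec.map_inv, ← Spec.map_comp] at h
  rw [h]
  congr 1
  rw [IsIso.Iso.inv_hom]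
  exact congr($(toSpec_c_app_top ρ) ≫ evalAt ⊤ V trivial)

/-- A compatible family of morphisms `Spec V ⟶ Y` whose closed points vary continuously glues to a
morphism `Z ⟶ Y`. -/
lemma exists_hom_localMap_eq (g : ∀ V : locallyRingedSpace Z hZ, Spec (ringAt V) ⟶ Y)
    (p : Spec (CommRingCat.of F) ⟶ Y) (hp : ∀ V, Spec.map (inclusion V) ≫ g V = p)
    (hg : Continuous fun V : locallyRingedSpace Z hZ =>
      g V (IsLocalRing.closedPoint (ringAt V))) :
    ∃ φ : locallyRingedSpace Z hZ ⟶ Y.toLocallyRingedSpace, ∀ V, localMap φ V = g V := by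
  let b : (locallyRingedSpace Z hZ).carrier ⟶ Y.carrier := TopCat.ofHom ⟨_, hg⟩
  have hb : ∀ (U : Y.Opens) (V : locallyRingedSpace Z hZ), V ∈ (Opens.map b).obj U →
      ⊤ ≤ g V ⁻¹ᵁ U := fun U V hV => top_le_preimage hV
  -- Viewed in `F`, the value along `g V` is the value along `p`, whatever `V` is. So the values
  -- form a constant function, that is, a section of the holomorphy sheaf.
  have hgp : ∀ (U : Y.Opens) (V : locallyRingedSpace Z hZ) (hV : V ∈ (Opens.map b).obj U),
      ∃ h, evalAlong (g V) U (hb U V hV) ≫ inclusion V = evalAlong p U h := by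
    rintro U V hV
    have h : ⊤ ≤ (Spec.map (inclusion V) ≫ g V) ⁻¹ᵁ U := fun x _ => hb U V hV trivial
    refine ⟨hp V ▸ h, ?_⟩
    rw [← evalAlong_specMap_comp _ _ _ _ h, evalAlong_congr (hp V)]
  let c : ∀ U : Y.Opens, Γ(Y, U) ⟶ (locallyRingedSpace Z hZ).presheaf.obj
      (op ((Opens.map b).obj U)) := fun U => CommRingCat.ofHom (S := sections ((Opens.map b).obj U))
    { toFun := fun s => ⟨fun V => (inclusion (hZ := hZ) V.1).hom
          ((evalAlong (g V.1) U (hb U V.1 V.2)).hom s), by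
        by_cases hU : ∃ V : locallyRingedSpace Z hZ, V ∈ (Opens.map b).obj U
        · obtain ⟨V, hV⟩ := hU
          obtain ⟨h, -⟩ := hgp U V hV
          refine ⟨(evalAlong p U h).hom s, fun W => ?_⟩
          obtain ⟨h', e⟩ := hgp U W.1 W.2
          have e' := congr($(e).hom s)
          refine ⟨e', ?_⟩
          rw [← e']
          exact ((evalAlong (g W.1) U (hb U W.1 W.2)).hom s).2
        · exact ⟨0, fun V => (hU ⟨V.1, V.2⟩).elim⟩⟩
      map_zero' := Subtype.ext (funext fun V => by simp)
      map_one' := Subtype.ext (funext fun V => by simp)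
      map_add' := fun _ _ => Subtype.ext (funext fun V => by simp)
      map_mul' := fun _ _ => Subtype.ext (funext fun V => by simp) }
  have hc : ∀ (U : Y.Opens) (V : locallyRingedSpace Z hZ) (hV : V ∈ (Opens.map b).obj U),
      c U ≫ evalAt _ V hV = evalAlong (g V) U (hb U V hV) := by
    intro U V hV
    ext s
    rfl
  let f : (locallyRingedSpace Z hZ).toPresheafedSpace ⟶ Y.toPresheafedSpace :=
    { base := b
      c := { app := fun U => c U.unop
             naturality := by
              intro U U' i
              ext s
              refine section_ext fun V hV => ?_
              have h₁ := congr($(hc U'.unop V hV).hom (Y.presheaf.map i s))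
              have h₂ := congr($(hc U.unop V (i.unop.le hV)).hom s)
              refine h₁.trans (Eq.trans ?_ h₂.symm)
              exact congr($(evalAlong_map (g V) i.unop.le (hb _ V hV)
                (hb _ V (i.unop.le hV))).hom s) } }
  -- The stalk map of `f` is identified with the one that `g V` induces at the closed point. The
  -- latter is local, and it determines `g V`; this gives both remaining claims.
  have hf : ∀ V : locallyRingedSpace Z hZ,
      f.stalkMap V ≫ stalkTo V = stalkClosedPointTo (g V) := by
    intro V
    refine TopCat.Presheaf.stalk_hom_ext _ fun U hU => ?_
    refine Eq.trans ?_ (germ_stalkClosedPointTo_eq_evalAlong (g V) U hU).symm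
    refine Eq.trans ?_ (hc U V hU)
    have := PresheafedSpace.stalkMap_germ f U V hU
    exact congr($this ≫ stalkTo V).trans
      congr(f.c.app (op U) ≫ $(germ_stalkTo ((Opens.map b).obj U) V hU))
  have hloc : ∀ V : locallyRingedSpace Z hZ, IsLocalHom (f.stalkMap V).hom := by
    intro V
    refine ⟨fun a ha => ?_⟩
    have h := ha.map (stalkTo V).hom
    have h' : (stalkTo V).hom ((f.stalkMap V).hom a) = (stalkClosedPointTo (g V)).hom a :=
      congr($(hf V).hom a)
    rw [h'] at h
    exact isUnit_of_map_unit (stalkClosedPointTo (g V)).hom _ h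
  refine ⟨⟨f, hloc⟩, fun V => ?_⟩
  refine Eq.trans ?_ (Spec_stalkClosedPointTo_fromSpecStalk (g V))
  exact congr(Spec.map $(hf V) ≫ Y.fromSpecStalk _)

end ZariskiRiemannSpace

/-! ### Valuative criteria and extension of rational maps -/

namespace AlgebraicGeometry.Scheme

lemma evalAlong_comp {X Y : Scheme.{u}} {R : CommRingCat.{u}} (f : Spec R ⟶ X) (g : X ⟶ Y)
    (U : X.Opens) (W : Y.Opens) (hf : ⊤ ≤ f ⁻¹ᵁ U) (hg : U ≤ g ⁻¹ᵁ W) (h : ⊤ ≤ (f ≫ g) ⁻¹ᵁ W) :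
    evalAlong (f ≫ g) W h = g.appLE W U hg ≫ evalAlong f U hf := by
  rw [evalAlong, evalAlong, ← Category.assoc, Scheme.Hom.appLE_comp_appLE]

lemma evalAlong_specMap_top {R S : CommRingCat.{u}} (ρ : R ⟶ S) (h) :
    evalAlong (Spec.map ρ) ⊤ h = (ΓSpecIso R).hom ≫ ρ := by
  rw [← ΓSpecIso_naturality]
  exact congr($((Scheme.Hom.app_eq_appLE (Spec.map ρ) (U := ⊤)).symm) ≫ (ΓSpecIso S).hom)

lemma specMap_evalAlong_fromSpec {Y : Scheme.{u}} {R : CommRingCat.{u}} (f : Spec R ⟶ Y)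
    {U : Y.Opens} (hU : IsAffineOpen U) (h : ⊤ ≤ f ⁻¹ᵁ U) :
    Spec.map (evalAlong f U h) ≫ hU.fromSpec = f := by
  have := IsAffineOpen.SpecMap_appLE_fromSpec f hU (isAffineOpen_top _) h
  rw [IsAffineOpen.fromSpec_top, Iso.eq_inv_comp, isoSpec_Spec_hom] at this
  rw [evalAlong, Spec.map_comp, Category.assoc, this]

lemma specMap_comp_injective {R S : CommRingCat.{u}} {ρ : R ⟶ S}
    (hρ : Function.Injective ρ.hom) {T : CommRingCat.{u}} {f g : Spec R ⟶ Spec T}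
    (h : Spec.map ρ ≫ f = Spec.map ρ ≫ g) : f = g := by
  obtain ⟨f, rfl⟩ := Spec.map_surjective f
  obtain ⟨g, rfl⟩ := Spec.map_surjective g
  rw [← Spec.map_comp, ← Spec.map_comp, Spec.map_inj] at h
  congr 1
  ext x
  exact hρ congr(($h).hom x)

section Valuative

variable {X Y : Scheme.{u}} (π : X ⟶ Y) {R K : CommRingCat.{u}} {ρ : R ⟶ K}

/-- A morphism from the spectrum of a valuation ring to a separated scheme is determined by its
restriction to the generic point. -/
lemma hom_ext_of_valuationRing [IsSeparated π] [IsDomain R] [ValuationRing R]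
    (hK : IsField K) (hρ : @IsFractionRing R _ K _ ρ.hom.toAlgebra) {f g : Spec R ⟶ X}
    (h : f ≫ π = g ≫ π) (h' : Spec.map ρ ≫ f = Spec.map ρ ≫ g) : f = g := by
  let _ := hK.toField
  let _ := ρ.hom.toAlgebra
  let S : ValuativeCommSq π :=
    { R := R
      K := K
      i₁ := Spec.map ρ ≫ f
      i₂ := f ≫ π
      commSq := ⟨Category.assoc _ _ _⟩ }
  -- Both `f` and `g` are lifts in the square built from `f`.
  have := IsSeparated.valuativeCriterion π S
  let a : S.commSq.LiftStruct := ⟨f, rfl, rfl⟩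
  let b : S.commSq.LiftStruct := ⟨g, h'.symm, h.symm⟩
  exact congr($(this.elim a b).l)

/-- A morphism from the generic point of the spectrum of a valuation ring to a proper scheme
extends to the whole spectrum. -/
lemma exists_lift_of_valuationRing [IsProper π] [IsDomain R] [ValuationRing R]
    (hK : IsField K) (hρ : @IsFractionRing R _ K _ ρ.hom.toAlgebra)
    (p : Spec K ⟶ X) (q : Spec R ⟶ Y) (h : p ≫ π = Spec.map ρ ≫ q) :
    ∃ f : Spec R ⟶ X, Spec.map ρ ≫ f = p ∧ f ≫ π = q := by
  let _ := hK.toField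
  let _ := ρ.hom.toAlgebra
  let S : ValuativeCommSq π :=
    { R := R
      K := K
      i₁ := p
      i₂ := q
      commSq := ⟨h⟩ }
  have h₁ : ValuativeCriterion.Existence π := by
    have : UniversallyClosed π := inferInstance
    rw [UniversallyClosed.eq_valuativeCriterion] at this
    exact this.1
  obtain ⟨⟨l⟩⟩ := h₁ S
  exact ⟨l.l, l.fac_left, l.fac_right⟩

end Valuative

lemma specMap_stalkSpecializes_fromSpecStalkOfMem {X : Scheme.{u}} (U : X.Opens) {x y : X}
    (h : y ⤳ x) (hx : x ∈ U) :
    Spec.map (X.presheaf.stalkSpecializes h) ≫ U.fromSpecStalkOfMem x hx =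
      U.fromSpecStalkOfMem y (h.mem_open U.2 hx) := by
  rw [← cancel_mono U.ι, Category.assoc, Opens.fromSpecStalkOfMem_ι, Opens.fromSpecStalkOfMem_ι,
    SpecMap_stalkSpecializes_fromSpecStalk]

/-- A rational map from an integral scheme whose stalks are valuation rings to a proper scheme is
defined everywhere. -/
lemma exists_extension_of_valuationRing_stalk {X Y S : Scheme.{u}} [IsIntegral X] [Y.IsSeparated]
    (sX : X ⟶ S) (sY : Y ⟶ S) [IsProper sY] (hX : ∀ x, ValuationRing (X.presheaf.stalk x))
    (p : Spec X.functionField ⟶ Y) (h : p ≫ sY = X.fromSpecStalk _ ≫ sX) :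
    ∃ γ : X ⟶ Y, X.fromSpecStalk (genericPoint X) ≫ γ = p := by
  let r := RationalMap.ofFunctionField sX sY p h
  have hr : r.domain = ⊤ := by
    refine top_unique fun x _ => ?_
    have hx := hX x
    let ρ : X.presheaf.stalk x ⟶ X.functionField :=
      X.presheaf.stalkSpecializes (genericPoint_specializes x)
    obtain ⟨l, hl, hl'⟩ := exists_lift_of_valuationRing sY (ρ := ρ)
      (Field.toIsField X.functionField)
      (inferInstanceAs (IsFractionRing (X.presheaf.stalk x) X.functionField))
      p (X.fromSpecStalk x ≫ sX)
      (by rw [h, ← SpecMap_stalkSpecializes_fromSpecStalk_assoc (genericPoint_specializes x)])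
    -- The lift to `Spec 𝒪_{X,x}` spreads out to a neighbourhood of `x`. The resulting partial map
    -- represents `r` because both agree at the generic point.
    refine RationalMap.mem_domain.2 ⟨PartialMap.ofFromSpecStalk sX sY l hl',
      PartialMap.mem_domain_ofFromSpecStalk sX sY l hl', ?_⟩
    apply RationalMap.eq_of_fromFunctionField_eq
    rw [RationalMap.fromFunctionField_ofFunctionField,
      RationalMap.fromFunctionField_toRationalMap, ← hl]
    refine Eq.trans ?_ congr(Spec.map ρ ≫
      $(PartialMap.fromSpecStalkOfMem_ofFromSpecStalk sX sY l hl'))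
    have := specMap_stalkSpecializes_fromSpecStalkOfMem
      (PartialMap.ofFromSpecStalk sX sY l hl').domain (genericPoint_specializes x)
      (PartialMap.mem_domain_ofFromSpecStalk sX sY l hl')
    exact congr($(this.symm) ≫ (PartialMap.ofFromSpecStalk sX sY l hl').hom).trans
      (Category.assoc _ _ _)
  -- Separatedness of `Y` provides a representative of `r` on its full domain of definition.
  have hdom : r.toPartialMap.domain = ⊤ := hr
  let γ : X ⟶ Y := X.topIso.inv ≫ (X.isoOfEq hdom).inv ≫ r.toPartialMap.hom
  have hγ : r.toPartialMap.domain.ι ≫ γ = r.toPartialMap.hom := by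
    have : r.toPartialMap.domain.ι = (X.isoOfEq hdom).hom ≫ X.topIso.hom := by simp
    rw [this]
    simp only [γ, Category.assoc, Iso.hom_inv_id_assoc]
  refine ⟨γ, ?_⟩
  have hp : r.toPartialMap.fromFunctionField = p := by
    rw [← RationalMap.fromFunctionField_toRationalMap, RationalMap.toRationalMap_toPartialMap,
      RationalMap.fromFunctionField_ofFunctionField]
  rw [← hp, PartialMap.fromFunctionField, PartialMap.fromSpecStalkOfMem]
  have hmem : genericPoint X ∈ r.toPartialMap.domain := hdom ▸ trivial
  rw [← r.toPartialMap.domain.fromSpecStalkOfMem_ι (genericPoint X) hmem, Category.assoc, hγ]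

end AlgebraicGeometry.Scheme

/-! ### Morphisms from `Z` to proper schemes over `D` -/

namespace ZariskiRiemannSpace

open AlgebraicGeometry.Scheme

variable {F : Type u} [Field F] {D : Subring F} {Z : Set (ZariskiRiemannSpace D)}
  {hZ : trivialRing D ∈ Z} {Y : Scheme.{u}}

instance (V : locallyRingedSpace Z hZ) : IsDomain (ringAt V) :=
  inferInstanceAs (IsDomain (V : topSpace Z).1.ring)

instance (V : locallyRingedSpace Z hZ) : ValuationRing (ringAt V) :=
  inferInstanceAs (ValuationRing (V : topSpace Z).1.ring)

lemma isFractionRing_ringAt (V : locallyRingedSpace Z hZ) :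
    @IsFractionRing (ringAt V) _ (CommRingCat.of F) _ (inclusion V).hom.toAlgebra :=
  inferInstanceAs (IsFractionRing (V : topSpace Z).1.ring F)

/-- Uniqueness in the valuative criterion applies to each `Spec V` separately. -/
lemma hom_ext_of_genericMap {S : Scheme.{u}} (π : Y ⟶ S) [IsSeparated π]
    {φ ψ : locallyRingedSpace Z hZ ⟶ Y.toLocallyRingedSpace}
    (h : φ ≫ π.toLRSHom = ψ ≫ π.toLRSHom) (h' : genericMap φ = genericMap ψ) : φ = ψ := by
  refine hom_ext_of_localMap fun V => hom_ext_of_valuationRing π (Field.toIsField F)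
    (isFractionRing_ringAt V) ?_ ?_
  · rw [← localMap_comp, ← localMap_comp, h]
  · rw [inclusion_localMap, inclusion_localMap, h']

/-- The inclusion of `D` in `F`. -/
def baseInclusion (D : Subring F) : CommRingCat.of D ⟶ CommRingCat.of F :=
  CommRingCat.ofHom D.subtype

/-- The inclusion of `D` in a valuation ring. -/
def baseToRingAt (V : locallyRingedSpace Z hZ) : CommRingCat.of D ⟶ ringAt V :=
  CommRingCat.ofHom (Subring.inclusion (V : topSpace Z).1.le_ring)

lemma baseToRingAt_comp_inclusion (V : locallyRingedSpace Z hZ) :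
    baseToRingAt V ≫ inclusion V = baseInclusion D := rfl

lemma localMap_structureMorphism (V : locallyRingedSpace Z hZ) :
    localMap (structureMorphism Z hZ) V = Spec.map (baseToRingAt V) :=
  localMap_toSpec (CommRingCat.ofHom (toGlobalSections Z)) V

lemma genericMap_structureMorphism :
    genericMap (structureMorphism Z hZ) = Spec.map (baseInclusion D) := by
  rw [genericMap, localMap_structureMorphism, ← Spec.map_comp, baseToRingAt_comp_inclusion]

/-- Every `F`-valued point over `D` of a proper scheme over `D` comes from a `D`-morphism from `Z`. -/
lemma exists_hom_genericMap_eq (π : Y ⟶ Spec (CommRingCat.of D)) [IsProper π]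
    (p : Spec (CommRingCat.of F) ⟶ Y) (hp : p ≫ π = Spec.map (baseInclusion D)) :
    ∃ φ : locallyRingedSpace Z hZ ⟶ Y.toLocallyRingedSpace,
      φ ≫ π.toLRSHom = structureMorphism Z hZ ∧ genericMap φ = p := by
  have hlift : ∀ V : locallyRingedSpace Z hZ, ∃ f : Spec (ringAt V) ⟶ Y,
      Spec.map (inclusion V) ≫ f = p ∧ f ≫ π = Spec.map (baseToRingAt V) := fun V =>
    exists_lift_of_valuationRing π (Field.toIsField F) (isFractionRing_ringAt V) p _
      (by rw [hp, ← Spec.map_comp, baseToRingAt_comp_inclusion])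
  choose g hgp hgπ using hlift
  have hg : Continuous fun V : locallyRingedSpace Z hZ =>
      g V (IsLocalRing.closedPoint (ringAt V)) := by
    refine continuous_def.2 fun O hO => isOpen_iff_mem_nhds.2 fun V hV => ?_
    obtain ⟨_, ⟨W, hW, rfl⟩, hVW, hWO⟩ :=
      Y.isBasis_affineOpens.exists_subset_of_mem_open hV hO
    replace hW : IsAffineOpen W := hW
    have htop : ⊤ ≤ g V ⁻¹ᵁ W := top_le_preimage hVW
    have hpW : ⊤ ≤ p ⁻¹ᵁ W := hgp V ▸ fun x _ => htop trivial
    have hθV : evalAlong (g V) W htop ≫ inclusion V = evalAlong p W hpW := by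
      have h : ⊤ ≤ (Spec.map (inclusion V) ≫ g V) ⁻¹ᵁ W := fun x _ => htop trivial
      rw [← evalAlong_specMap_comp _ _ _ _ h, evalAlong_congr (hgp V)]
    -- Finite type is what makes the closed points vary continuously: `Γ(Y, W)` is generated over
    -- `D` by a finite set `s`, and containing the images of `s` in `F` is an open condition on
    -- `V'`.
    have hft := π.finiteType_appLE (isAffineOpen_top (Spec (CommRingCat.of D))) hW le_top
    set τ := π.appLE ⊤ W le_top
    let _ := τ.hom.toAlgebra
    obtain ⟨s, hs⟩ := hft
    have hθτ : τ ≫ evalAlong p W hpW = (ΓSpecIso _).hom ≫ baseInclusion D := by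
      refine (evalAlong_comp p π W ⊤ hpW le_top fun _ _ => trivial).symm.trans ?_
      exact (evalAlong_congr hp _ _).trans (evalAlong_specMap_top _ _)
    let N : Set (locallyRingedSpace Z hZ) :=
      {V' | ∀ x ∈ s, (evalAlong p W hpW).hom x ∈ (V' : topSpace Z).1.ring}
    have hN : IsOpen N := by
      have : N = ⋂ x ∈ s, (Subtype.val : topSpace Z → ZariskiRiemannSpace D) ⁻¹'
          {V' | (evalAlong p W hpW).hom x ∈ V'.ring} := by
        ext V'
        exact ⟨fun h => Set.mem_iInter₂.2 h, fun h => Set.mem_iInter₂.1 h⟩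
      rw [this]
      exact isOpen_biInter_finset fun x _ =>
        (isOpen_setOf_mem _).preimage continuous_subtype_val
    have hVN : V ∈ N := fun x _ => by
      rw [← hθV]
      exact ((evalAlong (g V) W htop).hom x).2
    refine Filter.mem_of_superset (hN.mem_nhds hVN) fun V' hV' => hWO ?_
    have hrange : ∀ x, (evalAlong p W hpW).hom x ∈ (V' : topSpace Z).1.ring := by
      intro x
      have hx : x ∈ Algebra.adjoin Γ(Spec (CommRingCat.of D), ⊤) (s : Set Γ(Y, W)) :=
        hs ▸ Algebra.mem_top
      induction hx using Algebra.adjoin_induction with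
      | mem x hx => exact hV' x hx
      | algebraMap d =>
        have : (evalAlong p W hpW).hom (τ.hom d) = (baseInclusion D).hom ((ΓSpecIso _).hom.hom d) :=
          congr($(hθτ).hom d)
        exact this ▸ (V' : topSpace Z).1.le_ring (Subtype.prop _)
      | add x y _ _ hx hy => rw [map_add]; exact add_mem hx hy
      | mul x y _ _ hx hy => rw [map_mul]; exact mul_mem hx hy
    let θ : Γ(Y, W) ⟶ ringAt V' := CommRingCat.ofHom
      ((evalAlong p W hpW).hom.codRestrict (V' : topSpace Z).1.ring.toSubring hrange)
    have hθ : θ ≫ inclusion V' = evalAlong p W hpW := rfl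
    have hθp : Spec.map (inclusion V') ≫ Spec.map θ ≫ hW.fromSpec = p := by
      rw [← Spec.map_comp_assoc, hθ, specMap_evalAlong_fromSpec]
    -- For `V'` in `N`, the `F`-valued point extends to `Spec V'` inside `W`; by uniqueness of
    -- extensions this is `g V'`, so its closed point lies in `W`.
    have hgθ : g V' = Spec.map θ ≫ hW.fromSpec := by
      refine hom_ext_of_valuationRing π (Field.toIsField F) (isFractionRing_ringAt V') ?_
        ((hgp V').trans hθp.symm)
      refine specMap_comp_injective (inclusion_injective V') ?_
      rw [reassoc_of% hgp V', ← Category.assoc, hθp]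
    have : (Spec.map θ ≫ hW.fromSpec) (IsLocalRing.closedPoint (ringAt V')) ∈ W := by
      have h := Set.mem_range_self (f := hW.fromSpec)
        (Spec.map θ (IsLocalRing.closedPoint (ringAt V')))
      rw [hW.range_fromSpec] at h
      exact h
    exact Set.mem_of_eq_of_mem congr($hgθ (IsLocalRing.closedPoint (ringAt V'))) this
  obtain ⟨φ, hφ⟩ := exists_hom_localMap_eq g p hgp hg
  refine ⟨φ, hom_ext_of_localMap fun V => ?_, ?_⟩
  · rw [localMap_comp, hφ, hgπ, localMap_structureMorphism]
  · rw [genericMap, hφ, hgp]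

end ZariskiRiemannSpace

/-! ### The projective line and its points `[1 : t]` -/

section ProjectiveLinePoints

attribute [local instance] MvPolynomial.gradedAlgebra

open MvPolynomial HomogeneousLocalization

namespace projectiveLine

/-- The grading of `R[T₀, T₁]` by degree. -/
abbrev grading (R : Type u) [CommRing R] : ℕ → Submodule R (MvPolynomial (Fin 2) R) :=
  homogeneousSubmodule (Fin 2) R

instance (R : Type u) [CommRing R] : Scheme.IsSeparated (projectiveLine R) :=
  inferInstanceAs (Scheme.IsSeparated (Proj (grading R)))

/-- Serves to pass from properness over the degree-zero part of the grading to properness over `R`.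
-/
lemma algebraMap_zero_bijective (R : Type u) [CommRing R] :
    Function.Bijective (algebraMap R (grading R 0)) := by
  constructor
  · intro a b h
    exact C_injective (Fin 2) R congr(($h : MvPolynomial (Fin 2) R))
  · rintro ⟨x, hx⟩
    refine ⟨coeff 0 x, Subtype.ext ?_⟩
    exact (totalDegree_eq_zero_iff_eq_C.1 ((totalDegree_zero_iff_isHomogeneous _).2 hx)).symm

instance (R : Type u) [CommRing R] : IsProper (projectiveLineToSpec R) := by
  have : IsScalarTower R (grading R 0) (MvPolynomial (Fin 2) R) :=
    ⟨fun r a x => Algebra.smul_mul_assoc r (a : MvPolynomial (Fin 2) R) x⟩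
  have : Algebra.FiniteType (grading R 0) (MvPolynomial (Fin 2) R) :=
    Algebra.FiniteType.of_restrictScalars_finiteType R _ _
  have h₁ : IsProper (Proj.toSpecZero (grading R)) := inferInstance
  have h₂ : IsIso (CommRingCat.ofHom (algebraMap R (grading R 0))) :=
    (ConcreteCategory.isIso_iff_bijective _).2 (algebraMap_zero_bijective R)
  have h₃ : IsProper (Spec.map (CommRingCat.ofHom (algebraMap R (grading R 0)))) := inferInstance
  exact MorphismProperty.comp_mem @IsProper _ _ h₁ h₃

lemma X_mem (R : Type u) [CommRing R] (i : Fin 2) : (X i : MvPolynomial (Fin 2) R) ∈ grading R 1 :=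
  isHomogeneous_X R i

lemma X_mul_X_mem (R : Type u) [CommRing R] :
    (X 0 * X 1 : MvPolynomial (Fin 2) R) ∈ grading R (1 + 1) :=
  (isHomogeneous_X R 0).mul (isHomogeneous_X R 1)

section Chart

variable (R : Type u) [CommRing R]

/-- The standard affine chart `D₊(Tᵢ)`. -/
noncomputable def chart (i : Fin 2) :
    Spec (CommRingCat.of (Away (grading R) (X i))) ⟶ projectiveLine R :=
  Proj.awayι (grading R) (X i) (X_mem R i) one_pos

instance (i : Fin 2) : IsOpenImmersion (chart R i) :=
  inferInstanceAs (IsOpenImmersion (Proj.awayι (grading R) (X i) (X_mem R i) one_pos))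

lemma exists_mem_opensRange_chart (y : projectiveLine R) : ∃ i, y ∈ (chart R i).opensRange := by
  have h := Proj.iSup_basicOpen_eq_top' (grading R) (X : Fin 2 → _) (fun i => ⟨1, X_mem R i⟩) (by
    refine top_unique fun x _ => ?_
    have hx : x ∈ Algebra.adjoin R (Set.range (X : Fin 2 → MvPolynomial (Fin 2) R)) :=
      adjoin_range_X (R := R) (σ := Fin 2) ▸ Algebra.mem_top
    induction hx using Algebra.adjoin_induction with
    | mem x hx => exact Algebra.subset_adjoin hx
    | algebraMap d => exact Subalgebra.algebraMap_mem _ (algebraMap R (grading R 0) d)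
    | add x y _ _ hx hy => exact add_mem (hx trivial) (hy trivial)
    | mul x y _ _ hx hy => exact mul_mem (hx trivial) (hy trivial))
  have hy : y ∈ ⨆ i, Proj.basicOpen (grading R) (X i) := h.ge trivial
  obtain ⟨i, hi⟩ := Opens.mem_iSup.1 hy
  exact ⟨i, (Proj.opensRange_awayι (grading R) (X i) (X_mem R i) one_pos).ge hi⟩

/-- A morphism from a local scheme to the projective line lands in one of the two charts. -/
lemma exists_chart_lift {A : CommRingCat.{u}} [IsLocalRing A] (f : Spec A ⟶ projectiveLine R) :
    ∃ i, ∃ θ : CommRingCat.of (Away (grading R) (X i)) ⟶ A, Spec.map θ ≫ chart R i = f := by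
  obtain ⟨i, hi⟩ := exists_mem_opensRange_chart R (f (IsLocalRing.closedPoint A))
  have hr : Set.range f ⊆ Set.range (chart R i) := by
    rintro _ ⟨x, rfl⟩
    exact Scheme.top_le_preimage hi (show x ∈ (⊤ : (Spec A).Opens) from trivial)
  obtain ⟨θ, hθ⟩ := Spec.map_surjective (IsOpenImmersion.lift (chart R i) f hr)
  exact ⟨i, θ, by rw [hθ, IsOpenImmersion.lift_fac]⟩

/-- The coordinate `T₁ / T₀` on `D₊(T₀)`. -/
noncomputable def coord₀ : Away (grading R) (X 0 : MvPolynomial (Fin 2) R) :=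
  Away.mk (grading R) (X_mem R 0) 1 (X 1) (X_mem R 1)

/-- The coordinate `T₀ / T₁` on `D₊(T₁)`. -/
noncomputable def coord₁ : Away (grading R) (X 1 : MvPolynomial (Fin 2) R) :=
  Away.mk (grading R) (X_mem R 1) 1 (X 0) (X_mem R 0)

variable {R} {F : Type u} [Field F] [Algebra R F] {t : F} (ht : t ≠ 0)

lemma isUnit_aeval {t : F} (ht : t ≠ 0) :
    IsUnit ((aeval ![1, t] : MvPolynomial (Fin 2) R →ₐ[R] F).toRingHom (X 0 * X 1)) := by
  simpa using ht

/-- The homomorphism from the ring of functions on `D₊(T₀T₁)` to `F` that maps `T₁ / T₀` to `t`. -/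
noncomputable def pointHom : Away (grading R) (X 0 * X 1 : MvPolynomial (Fin 2) R) →+* F :=
  (IsLocalization.Away.lift (S := Localization.Away (X 0 * X 1 : MvPolynomial (Fin 2) R))
    (X 0 * X 1) (isUnit_aeval (R := R) ht)).comp (algebraMap _ _)

/-- At `(1, t)` the product `T₀T₁` takes the value `t`, so the factor `t ^ n` clears the denominator
`(T₀T₁) ^ n`. -/
lemma pointHom_mk (n : ℕ) (a : MvPolynomial (Fin 2) R) (ha) :
    pointHom ht (Away.mk (grading R) (X_mul_X_mem R) n a ha) * t ^ n = aeval ![1, t] a := by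
  have h : (Away.mk (grading R) (X_mul_X_mem R) n a ha).val *
      algebraMap _ _ ((X 0 * X 1 : MvPolynomial (Fin 2) R) ^ n) =
        algebraMap _ (Localization.Away (X 0 * X 1 : MvPolynomial (Fin 2) R)) a := by
    rw [Away.val_mk, Localization.mk_eq_mk']
    exact IsLocalization.mk'_spec _ _ _
  have h' := congr(IsLocalization.Away.lift (X 0 * X 1 : MvPolynomial (Fin 2) R)
    (isUnit_aeval (R := R) ht) $h)
  have e : (aeval ![1, t] : MvPolynomial (Fin 2) R →ₐ[R] F).toRingHom ((X 0 * X 1) ^ n) =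
      t ^ n := by simp
  rw [map_mul, IsLocalization.Away.lift_eq, IsLocalization.Away.lift_eq, e] at h'
  exact h'

/-- The `F`-valued point `[1 : t]` of the projective line. -/
noncomputable def point : Spec (CommRingCat.of F) ⟶ projectiveLine R :=
  Spec.map (CommRingCat.ofHom (pointHom ht)) ≫
    Proj.awayι (grading R) (X 0 * X 1) (X_mul_X_mem R) two_pos

lemma pointHom_fromZeroRingHom (a : grading R 0) :
    pointHom ht (fromZeroRingHom (grading R) _ a) =
      aeval ![1, t] (a : MvPolynomial (Fin 2) R) := by
  have h : (fromZeroRingHom (grading R) (.powers (X 0 * X 1 : MvPolynomial (Fin 2) R)) a).val =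
      algebraMap _ (Localization.Away (X 0 * X 1 : MvPolynomial (Fin 2) R)) a := rfl
  refine congr(IsLocalization.Away.lift (X 0 * X 1 : MvPolynomial (Fin 2) R)
    (isUnit_aeval (R := R) ht) $h).trans ?_
  exact IsLocalization.Away.lift_eq _ (isUnit_aeval (R := R) ht) _

lemma pointHom_comp :
    (CommRingCat.ofHom (algebraMap R (grading R 0)) ≫
      CommRingCat.ofHom (fromZeroRingHom (grading R) _)) ≫ CommRingCat.ofHom (pointHom ht) =
        CommRingCat.ofHom (algebraMap R F) := by
  ext r
  exact (pointHom_fromZeroRingHom ht _).trans (aeval_C _ r)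

lemma point_comp_projectiveLineToSpec :
    point ht ≫ projectiveLineToSpec R = Spec.map (CommRingCat.ofHom (algebraMap R F)) := by
  have h := Proj.awayι_toSpecZero (grading R) (X 0 * X 1) (X_mul_X_mem R) two_pos
  rw [← pointHom_comp ht, Spec.map_comp, Spec.map_comp, ← h, Category.assoc]
  exact Category.assoc _ _ _

lemma point_eq_chart₀ : ∃ θ : CommRingCat.of (Away (grading R) (X 0)) ⟶ CommRingCat.of F,
    Spec.map θ ≫ chart R 0 = point ht ∧ θ.hom (coord₀ R) = t := by
  refine ⟨CommRingCat.ofHom (awayMap (grading R) (X_mem R 1) rfl) ≫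
    CommRingCat.ofHom (pointHom ht), ?_, ?_⟩
  · rw [Spec.map_comp, Category.assoc]
    exact congr(_ ≫ $(Proj.SpecMap_awayMap_awayι (grading R) (X_mem R 0) one_pos (X_mem R 1) rfl))
  · have h := awayMap_mk (grading R) (X_mem R 1) (rfl : (X 0 * X 1 : MvPolynomial (Fin 2) R) = _)
      1 (X_mem R 0) (X 1) (X_mem R 1)
    -- On `D₊(T₀T₁)` the coordinate `T₁ / T₀` becomes `T₁² / (T₀T₁)`, with value `t² / t`.
    refine congr(pointHom ht $h).trans (mul_right_cancel₀ (pow_ne_zero 1 ht) ?_)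
    refine (pointHom_mk ht _ _ _).trans ?_
    simp

lemma point_eq_chart₁ : ∃ θ : CommRingCat.of (Away (grading R) (X 1)) ⟶ CommRingCat.of F,
    Spec.map θ ≫ chart R 1 = point ht ∧ θ.hom (coord₁ R) = t⁻¹ := by
  refine ⟨CommRingCat.ofHom (awayMap (grading R) (X_mem R 0) (mul_comm _ _)) ≫
    CommRingCat.ofHom (pointHom ht), ?_, ?_⟩
  · rw [Spec.map_comp, Category.assoc]
    exact congr(_ ≫ $(Proj.SpecMap_awayMap_awayι (grading R) (X_mem R 1) one_pos (X_mem R 0)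
      (mul_comm _ _)))
  · have h := awayMap_mk (grading R) (X_mem R 0)
      (mul_comm _ _ : (X 0 * X 1 : MvPolynomial (Fin 2) R) = _) 1 (X_mem R 1) (X 0) (X_mem R 0)
    -- Here `T₀ / T₁` becomes `T₀² / (T₀T₁)`, with value `1 / t`.
    refine congr(pointHom ht $h).trans (mul_right_cancel₀ (pow_ne_zero 1 ht) ?_)
    refine (pointHom_mk ht _ _ _).trans ?_
    simp [ht]

/-- If the point `[1 : t]` extends to the spectrum of a local ring, then `t` or `t⁻¹` comes from
this local ring. -/
lemma mem_range_or_inv_mem_range {A : CommRingCat.{u}} [IsLocalRing A]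
    (ρ : A ⟶ CommRingCat.of F) (f : Spec A ⟶ projectiveLine R) (h : Spec.map ρ ≫ f = point ht) :
    t ∈ ρ.hom.range ∨ t⁻¹ ∈ ρ.hom.range := by
  obtain ⟨i, θ, rfl⟩ := exists_chart_lift R f
  rw [← Spec.map_comp_assoc] at h
  fin_cases i
  -- A chart is a monomorphism, so the lift of `[1 : t]` to it is unique and the coordinate, which
  -- comes from `A`, takes the value `t`.
  · obtain ⟨τ, hτ, hτt⟩ := point_eq_chart₀ (R := R) ht
    have := Spec.map_injective ((cancel_mono _).1 (h.trans hτ.symm))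
    exact Or.inl ⟨θ.hom (coord₀ R), congr(($this).hom (coord₀ R)).trans hτt⟩
  · obtain ⟨τ, hτ, hτt⟩ := point_eq_chart₁ (R := R) ht
    have := Spec.map_injective ((cancel_mono _).1 (h.trans hτ.symm))
    exact Or.inr ⟨θ.hom (coord₁ R), congr(($this).hom (coord₁ R)).trans hτt⟩

end Chart

end projectiveLine

end ProjectiveLinePoints

/-! ### Prüfer domains -/

lemma IsPruferDomain.valuationRing_stalk (A : CommRingCat.{u}) [IsDomain A] [IsPruferDomain A]
    (x : Spec A) : ValuationRing ((Spec A).presheaf.stalk x) := by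
  have hx : (PrimeSpectrum.asIdeal x).IsPrime := PrimeSpectrum.isPrime x
  have := IsPruferDomain.valuationRing_localization (PrimeSpectrum.asIdeal x)
  exact Function.Surjective.valuationRing (Spec.stalkIso A x).inv.hom
    (ConcreteCategory.bijective_of_isIso (Spec.stalkIso A x).inv).surjective

/-- A morphism from the generic point of a Prüfer domain to a proper scheme extends to the whole
spectrum. -/
lemma IsPruferDomain.exists_extension {A : CommRingCat.{u}} {F : Type u} [IsDomain A]
    [IsPruferDomain A] [Field F] [Algebra A F] [IsFractionRing A F] {Y S : Scheme.{u}}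
    [Y.IsSeparated] (π : Y ⟶ S) [IsProper π] (p : Spec (CommRingCat.of F) ⟶ Y) (q : Spec A ⟶ S)
    (h : p ≫ π = Spec.map (CommRingCat.ofHom (algebraMap A F)) ≫ q) :
    ∃ γ : Spec A ⟶ Y, Spec.map (CommRingCat.ofHom (algebraMap A F)) ≫ γ = p := by
  let K := (Spec A).functionField
  let e : F ≃ₐ[A] K := IsLocalization.algEquiv (nonZeroDivisors A) F K
  let e' : CommRingCat.of F ≅ K := e.toRingEquiv.toCommRingCatIso
  have he : CommRingCat.ofHom (algebraMap A F) ≫ e'.hom = CommRingCat.ofHom (algebraMap A K) := by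
    ext a
    exact e.commutes a
  have he' : Spec.map e'.hom ≫ Spec.map (CommRingCat.ofHom (algebraMap A F)) =
      (Spec A).fromSpecStalk (genericPoint (Spec A)) := by
    rw [← Spec.map_comp, he]
    exact (Spec.fromSpecStalk_eq' A _).symm
  obtain ⟨γ, hγ⟩ := Scheme.exists_extension_of_valuationRing_stalk q π
    (IsPruferDomain.valuationRing_stalk A) (Spec.map e'.hom ≫ p)
    (by rw [Category.assoc, h, ← he', Category.assoc])
  refine ⟨γ, ?_⟩
  rw [← he', Category.assoc] at hγ
  exact (cancel_epi _).1 hγ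

/-- A subring of a field is a Prüfer domain with this field as quotient field if each nonzero
element of the field or its inverse lies in each localization of the subring. -/
lemma isPruferDomain_and_isFractionRing {A F : Type u} [CommRing A] [IsDomain A] [Field F]
    [Algebra A F] (hA : Function.Injective (algebraMap A F))
    (h : ∀ (P : Ideal A) [P.IsPrime] (ρ : Localization.AtPrime P →+* F),
      ρ.comp (algebraMap A _) = algebraMap A F → ∀ t : F, t ≠ 0 → t ∈ ρ.range ∨ t⁻¹ ∈ ρ.range) :
    IsPruferDomain A ∧ IsFractionRing A F := by
  have hρ : ∀ (P : Ideal A) [P.IsPrime], ∃ ρ : Localization.AtPrime P →+* F,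
      ρ.comp (algebraMap A _) = algebraMap A F := by
    intro P _
    have hP : ∀ y : P.primeCompl, IsUnit (algebraMap A F y) := fun y => by
      refine IsUnit.mk0 _ fun hy => y.2 ?_
      rw [(map_eq_zero_iff _ hA).1 hy]
      exact P.zero_mem
    exact ⟨IsLocalization.lift hP, IsLocalization.lift_comp hP⟩
  constructor
  · refine ⟨fun P _ => ?_⟩
    obtain ⟨ρ, hρA⟩ := hρ P
    have hinj : Function.Injective ρ := by
      have : ρ = IsLocalization.lift (M := P.primeCompl) (g := algebraMap A F)
          fun y => by
            rw [← hρA]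
            exact (IsLocalization.map_units (Localization.AtPrime P) y).map ρ := by
        refine IsLocalization.ringHom_ext P.primeCompl ?_
        rw [IsLocalization.lift_comp, hρA]
      rw [this]
      refine IsLocalization.lift_injective_iff _ |>.2 fun x y => ?_
      rw [(IsLocalization.injective _ P.primeCompl_le_nonZeroDivisors).eq_iff, hA.eq_iff]
    refine { cond' := fun a b => ?_ }
    by_cases ha : a = 0
    · exact ⟨0, Or.inr (by simp [ha])⟩
    by_cases hb : b = 0
    · exact ⟨0, Or.inl (by simp [hb])⟩
    have ha' : ρ a ≠ 0 := (map_ne_zero_iff _ hinj).2 ha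
    have hb' : ρ b ≠ 0 := (map_ne_zero_iff _ hinj).2 hb
    -- Divisibility between `a` and `b` is tested on the quotient of their images in `F`.
    obtain ⟨c, hc⟩ | ⟨c, hc⟩ := h P ρ hρA (ρ b / ρ a) (div_ne_zero hb' ha')
    · refine ⟨c, Or.inl (hinj ?_)⟩
      rw [map_mul, hc]
      field_simp
    · refine ⟨c, Or.inr (hinj ?_)⟩
      rw [map_mul, hc]
      field_simp
  -- The zero ideal gives the quotient field: elements coming from the localization at `⊥` are
  -- fractions of elements of `A`, and so are their inverses.
  · obtain ⟨ρ, hρA⟩ := hρ ⊥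
    have := (faithfulSMul_iff_algebraMap_injective A F).2 hA
    have hfrac : ∀ t ∈ ρ.range, ∃ x y, t = algebraMap A F x / algebraMap A F y := by
      rintro _ ⟨r, rfl⟩
      obtain ⟨x, y, rfl⟩ := IsLocalization.exists_mk'_eq (⊥ : Ideal A).primeCompl r
      refine ⟨x, y, ?_⟩
      have hy : algebraMap A F y ≠ 0 := (map_ne_zero_iff _ hA).2 fun hy => y.2 hy
      rw [eq_div_iff hy, ← hρA, RingHom.comp_apply, RingHom.comp_apply, ← map_mul,
        IsLocalization.mk'_spec]
    refine IsFractionRing.of_field A F fun t => ?_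
    by_cases ht : t = 0
    · exact ⟨0, 1, by simp [ht]⟩
    obtain ht' | ht' := h ⊥ ρ hρA t ht
    · exact hfrac t ht'
    · obtain ⟨x, y, hxy⟩ := hfrac _ ht'
      exact ⟨y, x, by rw [← inv_inv t, hxy, inv_div]⟩

/-! ### Morphisms from `Z` to affine schemes and the holomorphy ring -/

namespace ZariskiRiemannSpace

open AlgebraicGeometry.Scheme

variable {F : Type u} [Field F] {D : Subring F} {Z : Set (ZariskiRiemannSpace D)}
  {hZ : trivialRing D ∈ Z} {Y : Scheme.{u}}

/-- Morphisms from `Z` to an affine scheme are determined by their restrictions to the generic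
point. -/
lemma hom_ext_of_genericMap_of_Spec {R : CommRingCat.{u}}
    {φ ψ : locallyRingedSpace Z hZ ⟶ (Spec R).toLocallyRingedSpace}
    (h : genericMap φ = genericMap ψ) : φ = ψ :=
  hom_ext_of_localMap fun V => specMap_comp_injective (inclusion_injective V) <| by
    rw [inclusion_localMap, inclusion_localMap, h]

lemma mem_holomorphyRing {x : F} : x ∈ holomorphyRing Z ↔ ∀ V ∈ Z, x ∈ V.ring := by
  simp only [holomorphyRing, Subring.mem_iInf]
  rfl

/-- The inclusion of the holomorphy ring in `F`. -/
def holomorphyInclusion (Z : Set (ZariskiRiemannSpace D)) :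
    CommRingCat.of (holomorphyRing Z) ⟶ CommRingCat.of F :=
  CommRingCat.ofHom (algebraMap (holomorphyRing Z) F)

/-- Elements of the holomorphy ring as global sections. -/
noncomputable def holomorphyToSections (hZ : trivialRing D ∈ Z) :
    CommRingCat.of (holomorphyRing Z) ⟶ (locallyRingedSpace Z hZ).presheaf.obj (op ⊤) :=
  CommRingCat.ofHom (S := sections (⊤ : Opens (topSpace Z)))
    { toFun := fun a => constSection ⊤ a.1 fun V => mem_holomorphyRing.1 a.2 V.1.1 V.1.2
      map_zero' := rfl
      map_one' := rfl
      map_add' := fun _ _ => rfl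
      map_mul' := fun _ _ => rfl }

lemma holomorphyToSections_evalAt (V : locallyRingedSpace Z hZ) :
    (holomorphyToSections hZ ≫ evalAt ⊤ V trivial) ≫ inclusion V = holomorphyInclusion Z := rfl

/-- Global sections as elements of the holomorphy ring. -/
noncomputable def sectionsToHolomorphy (hZ : trivialRing D ∈ Z) :
    (locallyRingedSpace Z hZ).presheaf.obj (op ⊤) ⟶ CommRingCat.of (holomorphyRing Z) :=
  CommRingCat.ofHom <|
    (evalAt ⊤ (generic hZ) trivial ≫ inclusion (generic hZ)).hom.codRestrict (holomorphyRing Z)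
      fun s => mem_holomorphyRing.2 fun V hV => by
        rw [evalAt_comp_inclusion ⊤ (generic hZ) (⟨V, hV⟩ : topSpace Z) trivial trivial]
        exact ((evalAt (hZ := hZ) ⊤ (⟨V, hV⟩ : topSpace Z) trivial).hom s).2

lemma sectionsToHolomorphy_comp :
    sectionsToHolomorphy hZ ≫ holomorphyInclusion Z =
      evalAt ⊤ (generic hZ) trivial ≫ inclusion (generic hZ) := rfl

/-- The generic point of a morphism from `Z` to an affine scheme extends to the spectrum of the
holomorphy ring. -/
lemma exists_holomorphyInclusion_comp_eq_genericMap {S : Scheme.{u}} [IsAffine S]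
    (δ : locallyRingedSpace Z hZ ⟶ S.toLocallyRingedSpace) :
    ∃ η : Spec (CommRingCat.of (holomorphyRing Z)) ⟶ S,
      Spec.map (holomorphyInclusion Z) ≫ η = genericMap δ := by
  refine ⟨Spec.map (δ.c.app (op ⊤) ≫ sectionsToHolomorphy hZ) ≫ S.isoSpec.inv, ?_⟩
  rw [← Category.assoc, Iso.comp_inv_eq, ← Spec.map_comp, genericMap, Category.assoc]
  refine Eq.trans ?_ congr(Spec.map (inclusion (generic hZ)) ≫
    $((localMap_comp_toSpecΓ δ (generic hZ)).symm))
  exact (congr(Spec.map (δ.c.app (op ⊤) ≫ $sectionsToHolomorphy_comp))).trans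
    (Spec.map_comp (δ.c.app (op ⊤) ≫ evalAt ⊤ (generic hZ) trivial) (inclusion (generic hZ)))

end ZariskiRiemannSpace

/-! ### The equivalence -/

open ZariskiRiemannSpace in
theorem theorem3p1 {F : Type u} [Field F] (D : Subring F) (Z : Set (ZariskiRiemannSpace D))
    (hZ : ZariskiRiemannSpace.trivialRing D ∈ Z) :
    (IsPruferDomain (ZariskiRiemannSpace.holomorphyRing Z) ∧
        IsFractionRing (ZariskiRiemannSpace.holomorphyRing Z) F) ↔
      ∀ φ : ZariskiRiemannSpace.locallyRingedSpace Z hZ ⟶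
          (projectiveLine D).toLocallyRingedSpace,
        φ ≫ (projectiveLineToSpec D).toLRSHom = ZariskiRiemannSpace.structureMorphism Z hZ →
          FactorsThroughAffine φ := by
  constructor
  · rintro ⟨_, _⟩ φ hφ
    let q : Spec (CommRingCat.of (holomorphyRing Z)) ⟶ Spec (CommRingCat.of D) :=
      Spec.map (CommRingCat.ofHom (Subring.inclusion fun x hx =>
        mem_holomorphyRing.2 fun V _ => V.le_ring hx))
    have hp : genericMap φ ≫ projectiveLineToSpec D = Spec.map (holomorphyInclusion Z) ≫ q := by
      rw [← genericMap_comp, hφ, genericMap_structureMorphism, ← Spec.map_comp]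
      rfl
    obtain ⟨γ, hγ⟩ := IsPruferDomain.exists_extension
      (A := CommRingCat.of (holomorphyRing Z)) (projectiveLineToSpec D) (genericMap φ) q hp
    have hδ : genericMap (toSpec (holomorphyToSections hZ)) = Spec.map (holomorphyInclusion Z) := by
      rw [genericMap, localMap_toSpec, ← Spec.map_comp, holomorphyToSections_evalAt]
    have hδγ : genericMap (toSpec (holomorphyToSections hZ) ≫ γ.toLRSHom) = genericMap φ := by
      rw [genericMap_comp, hδ]
      exact hγ
    refine ⟨_, inferInstance, toSpec (holomorphyToSections hZ), γ, ?_⟩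
    refine hom_ext_of_genericMap (projectiveLineToSpec D) ?_ hδγ
    -- `γ` was not shown to be a morphism over `D`. This is not needed: the two composites to the
    -- affine scheme `Spec D` can be compared on `Spec F`.
    refine hom_ext_of_genericMap_of_Spec ?_
    exact (genericMap_comp _ _).trans
      (congr($hδγ ≫ projectiveLineToSpec D).trans (genericMap_comp _ _).symm)
  · intro h
    refine isPruferDomain_and_isFractionRing Subtype.val_injective fun P _ ρ hρ t ht => ?_
    obtain ⟨φ, hφ, hφt⟩ := exists_hom_genericMap_eq (hZ := hZ) (projectiveLineToSpec D)
      (projectiveLine.point (R := D) ht) (projectiveLine.point_comp_projectiveLineToSpec ht)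
    obtain ⟨S, _, δ, γ, rfl⟩ := h φ hφ
    obtain ⟨η, hη⟩ := exists_holomorphyInclusion_comp_eq_genericMap δ
    -- The extension of `[1 : t]` to the local scheme is `Spec A_P ⟶ Spec A ⟶ S ⟶ ℙ¹`.
    refine projectiveLine.mem_range_or_inv_mem_range ht (CommRingCat.ofHom ρ)
      (Spec.map (CommRingCat.ofHom (algebraMap _ _)) ≫ η ≫ γ) ?_
    rw [← Spec.map_comp_assoc, ← CommRingCat.ofHom_comp, hρ, ← hφt, genericMap_comp, ← hη,
      Category.assoc]
    rfl
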